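/- All rings are commutative with $1$; a local ring is a ring with exactly one maximal ideal (not necessarily Noetherian). An ideal is regular if it contains a nonzerodivisor, and stable if it is projective as a module over its ring of endomorphisms. A ring is finitely stable if each of its finitely generated regular ideals is stable. An extension of rings $R \subseteq S$ is quadratic if $xy \in xR + yR + R$ for all $x, y \in S$. For a ring $R$ with total ring of quotients $Q(R)$ whose Jacobson radical $\operatorname{Jac} R$ is regular, put $R_0 = R$, $R_i = \{q \in Q(R) : q \operatorname{Jac} R_{i-1} \subseteq \operatorname{Jac} R_{i-1}\}$ for $i \ge 1$ (this is the endomorphism ring of $\operatorname{Jac} R_{i-1}$), and $R_\infty = \bigcup_{i \ge 1} R_i$. Such an $R$ is a quadratic ring if it is local, $R \subseteq R_\infty$ is a quadratic extension, and the maximal ideal of $R$ is stable and regular. **Theorem.** Let $R$ be a finitely stable local ring whose maximal ideal is stable and regular. Then $R$ is a quadratic ring, and $R_\infty$ has at most two maximal ideals. -/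

import Mathlib

open scoped nonZeroDivisors

namespace StableRings

section Ideals

variable {R : Type*} [CommRing R]

/-- An ideal is regular if it contains a nonzerodivisor. -/
def IsRegularIdeal (I : Ideal R) : Prop :=
  ∃ x ∈ I, x ∈ R⁰

/-- An ideal is stable if it is projective over its ring of endomorphisms. -/
def IsStableIdeal (I : Ideal R) : Prop :=
  Module.Projective (Module.End R I) I

variable (R) in
/-- A ring is finitely stable if each of its finitely generated regular ideals is stable. -/
def IsFinitelyStable : Prop :=
  ∀ I : Ideal R, I.FG → IsRegularIdeal I → IsStableIdeal I

end Ideals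

/-- `S` is a quadratic extension of `R`: `R` embeds into `S`, and `x y ∈ x R + y R + R`
for all `x, y ∈ S`. -/
structure IsQuadraticExtension (R S : Type*) [CommRing R] [CommRing S] [Algebra R S] : Prop where
  injective : Function.Injective (algebraMap R S)
  mul_mem : ∀ x y : S, ∃ a b c : R, x * y = a • x + b • y + algebraMap R S c

section Tower

variable {R K : Type*} [CommRing R] [CommRing K] [Algebra R K]

/-- The ring `E(I) = {q ∈ K : q I ⊆ I}`, for an `R`-submodule `I` of `K`. -/
def endRing (I : Submodule R K) : Subalgebra R K where
  carrier := {q | ∀ x ∈ I, q * x ∈ I}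
  mul_mem' {a b} ha hb x hx := by
    rw [mul_assoc]
    exact ha _ (hb _ hx)
  add_mem' {a b} ha hb x hx := by
    rw [add_mul]
    exact I.add_mem (ha _ hx) (hb _ hx)
  algebraMap_mem' r x hx := by
    rw [← Algebra.smul_def]
    exact I.smul_mem r hx

/-- The Jacobson radical of an intermediate ring `A` of `K / R`, as an `R`-submodule of `K`. -/
def jac (A : Subalgebra R K) : Submodule R K :=
  ((Ring.jacobson A).restrictScalars R).map A.val.toLinearMap

theorem mem_jac {A : Subalgebra R K} {x : K} :
    x ∈ jac A ↔ ∃ y : A, y ∈ Ring.jacobson A ∧ (y : K) = x :=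
  Iff.rfl

variable (R K) in
/-- The tower of rings `R₀ = R`, `Rᵢ₊₁ = E(Jac Rᵢ)`, inside `K`
(which is meant to be the total ring of quotients of `R`). -/
def tower : ℕ → Subalgebra R K
  | 0 => ⊥
  | i + 1 => endRing (jac (tower i))

theorem le_endRing_jac (A : Subalgebra R K) : A ≤ endRing (jac A) := by
  rintro a ha x hx
  obtain ⟨y, hy, rfl⟩ := mem_jac.1 hx
  exact mem_jac.2 ⟨⟨a, ha⟩ * y, Ideal.mul_mem_left _ _ hy, rfl⟩

theorem tower_mono : Monotone (tower R K) :=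
  monotone_nat_of_le_succ fun i => le_endRing_jac (tower R K i)

variable (R K) in
/-- The union `R_∞` of the rings `R₁ ⊆ R₂ ⊆ ⋯` of the tower. -/
def towerUnion : Subalgebra R K where
  carrier := ⋃ i : ℕ, (tower R K (i + 1) : Set K)
  mul_mem' {a b} ha hb := by
    obtain ⟨i, hi⟩ := Set.mem_iUnion.1 ha
    obtain ⟨j, hj⟩ := Set.mem_iUnion.1 hb
    exact Set.mem_iUnion.2 ⟨max i j, mul_mem (tower_mono (by omega) hi) (tower_mono (by omega) hj)⟩
  add_mem' {a b} ha hb := by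
    obtain ⟨i, hi⟩ := Set.mem_iUnion.1 ha
    obtain ⟨j, hj⟩ := Set.mem_iUnion.1 hb
    exact Set.mem_iUnion.2 ⟨max i j, add_mem (tower_mono (by omega) hi) (tower_mono (by omega) hj)⟩
  algebraMap_mem' r := Set.mem_iUnion.2 ⟨0, Subalgebra.algebraMap_mem _ r⟩

end Tower

/-- A ring `R` with total ring of quotients `K` is a quadratic ring if it is local, `R ⊆ R_∞` is a
quadratic extension, and the maximal ideal of `R` is stable and regular. -/
structure IsQuadraticRing (R K : Type*) [CommRing R] [CommRing K] [Algebra R K]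
    [IsFractionRing R K] : Prop extends IsLocalRing R where
  quadratic : IsQuadraticExtension R (towerUnion R K)
  stable : IsStableIdeal (IsLocalRing.maximalIdeal R)
  regular : IsRegularIdeal (IsLocalRing.maximalIdeal R)

end StableRings

namespace StableRings

/-! ### Jacobson radicals and units of intermediate rings -/

section Subalgebras

variable {R K : Type*} [CommRing R] [CommRing K] [Algebra R K]

/-! Everything follows from one property, `HasReductions`: a finitely generated fractional ideal I
containing a unit of K satisfies I² = zI for some z ∈ I. Stability makes I invertible over E(I);
then E(I) is finite over the local ring R, hence semilocal, so I = zE(I) and I² = zI.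

For a ring S between R and K that is integral over R, this property already gives both conclusions.
Applied to I = (x, y, 1), it makes z a unit of E(I), so xy ∈ I (`HasReductions.exists_mul_eq`).
Three maximal ideals of S would give a quadratic equation with three distinct roots in the residue
field of R (`HasReductions.encard_isMaximal_le_two`).

It remains to see that R_∞ is integral over R. The invariant along the tower is `HasPrincipalJac`: A
is local and Jac A = mE(Jac A) with m a unit of K. It makes B = E(Jac A) integral; then either Jac B
= Jac A, and the tower stops, or B satisfies the invariant again (`HasPrincipalJac.endRing_jac`). -/

theorem mem_jac_iff {A : Subalgebra R K} {x : K} :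
    x ∈ jac A ↔ x ∈ A ∧ ∀ a ∈ A, ∃ b ∈ A, (x * a + 1) * b = 1 := by
  rw [mem_jac]
  simp_rw [← Ideal.jacobson_bot, Ideal.mem_jacobson_bot, isUnit_iff_exists_inv]
  constructor
  · rintro ⟨y, hy, rfl⟩
    refine ⟨y.2, fun a ha => ?_⟩
    obtain ⟨b, hb⟩ := hy ⟨a, ha⟩
    exact ⟨b, b.2, congrArg Subtype.val hb⟩
  · rintro ⟨hx, h⟩
    refine ⟨⟨x, hx⟩, fun a => ?_, rfl⟩
    obtain ⟨b, hb, h⟩ := h a a.2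
    exact ⟨⟨b, hb⟩, Subtype.ext h⟩

theorem jac_le {A : Subalgebra R K} {x : K} (hx : x ∈ jac A) : x ∈ A :=
  (mem_jac_iff.1 hx).1

theorem mul_mem_jac {A : Subalgebra R K} {a x : K} (ha : a ∈ A) (hx : x ∈ jac A) :
    a * x ∈ jac A :=
  le_endRing_jac A ha x hx

theorem one_notMem_jac [Nontrivial K] (A : Subalgebra R K) : (1 : K) ∉ jac A := fun h => by
  obtain ⟨b, -, hb⟩ := (mem_jac_iff.1 h).2 (-1) (neg_mem A.one_mem)
  simp at hb

theorem coe_mem_jac {A : Subalgebra R K} {x : A} :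
    (x : K) ∈ jac A ↔ ∀ Q : Ideal A, Q.IsMaximal → x ∈ Q := by
  trans x ∈ Ring.jacobson A
  · simp [mem_jac]
  · rw [Ring.jacobson_eq_sInf_isMaximal, Submodule.mem_sInf]
    rfl

/-- An element of `A` congruent to a unit modulo `jac A` is a unit. -/
theorem exists_mul_eq_one_of_sub_mem_jac {A : Subalgebra R K} {x u v : K} (hv : v ∈ A)
    (huv : u * v = 1) (h : x - u ∈ jac A) : ∃ y ∈ A, x * y = 1 := by
  obtain ⟨b, hb, e⟩ := (mem_jac_iff.1 h).2 v hv
  exact ⟨v * b, mul_mem hv hb, by linear_combination e + b * huv⟩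

theorem jac_le_jac_endRing_jac (A : Subalgebra R K) : jac A ≤ jac (endRing (jac A)) := by
  intro x hx
  refine mem_jac_iff.2 ⟨le_endRing_jac A (jac_le hx), fun a ha => ?_⟩
  obtain ⟨b, hb, e⟩ := (mem_jac_iff.1 (ha x hx)).2 1 A.one_mem
  exact ⟨b, le_endRing_jac A hb, by linear_combination e⟩

theorem mem_jac_of_sq_mem {A : Subalgebra R K} {x : K} (hx : x ∈ A) (h : x ^ 2 ∈ jac A) :
    x ∈ jac A := by
  lift x to A using hx
  rw [← A.coe_pow, coe_mem_jac] at h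
  exact coe_mem_jac.2 fun Q hQ => hQ.isPrime.mem_of_pow_mem _ (h Q hQ)

theorem exists_isMaximal_notMem {A : Subalgebra R K} {x : A} (h : (x : K) ∉ jac A) :
    ∃ Q : Ideal A, Q.IsMaximal ∧ x ∉ Q := by
  rw [coe_mem_jac] at h
  push Not at h
  exact h

theorem algebraIsIntegral {S : Subalgebra R K} (hS : ∀ x ∈ S, IsIntegral R x) :
    Algebra.IsIntegral R S :=
  ⟨fun x => (isIntegral_algHom_iff S.val Subtype.val_injective).1 (hS x x.2)⟩

variable [IsLocalRing R]

theorem algebraMap_mem_iff_of_isMaximal {S : Subalgebra R K} (hS : ∀ x ∈ S, IsIntegral R x)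
    {Q : Ideal S} (hQ : Q.IsMaximal) {r : R} :
    algebraMap R S r ∈ Q ↔ r ∈ IsLocalRing.maximalIdeal R := by
  have := algebraIsIntegral hS
  rw [← IsLocalRing.eq_maximalIdeal (Ideal.isMaximal_comap_of_isIntegral_of_isMaximal (R := R) Q)]
  rfl

theorem algebraMap_mem_jac {S : Subalgebra R K} (hS : ∀ x ∈ S, IsIntegral R x) {r : R}
    (hr : r ∈ IsLocalRing.maximalIdeal R) : algebraMap R K r ∈ jac S :=
  (coe_mem_jac (x := algebraMap R S r)).2 fun _ hQ =>
    (algebraMap_mem_iff_of_isMaximal hS hQ).2 hr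

end Subalgebras

/-! ### Integral extensions under `HasReductions`: quadraticity and the bound on maximal ideals -/

section Reductions

variable (R K : Type*) [CommRing R] [CommRing K] [Algebra R K]

/-- Every finitely generated fractional ideal `I` of `R` that contains a unit of `K` satisfies
`I ^ 2 = z I` for some `z ∈ I`. -/
def HasReductions : Prop :=
  ∀ I : Submodule R K, I.FG → (∃ u ∈ I, IsUnit u) →
    ∃ z ∈ I, ∀ x ∈ I, ∀ y ∈ I, ∃ w ∈ I, x * y = z * w

variable {R K}

/-- Multiplying a monic equation of degree n + 1 for x by yⁿ writes x as a polynomial in y. -/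
theorem mem_of_isIntegral_of_mul_eq_one {S : Subalgebra R K} {x y : K} (hx : IsIntegral R x)
    (hxy : x * y = 1) (hy : y ∈ S) : x ∈ S := by
  obtain ⟨p, hp, he⟩ := hx
  have key : ∀ n : ℕ, ∀ q : Polynomial R, q.natDegree ≤ n → 
      q.eval₂ (algebraMap R K) x * y ^ n ∈ S := by
    intro n q hq
    rw [Polynomial.eval₂_eq_sum_range' _ (Nat.lt_succ_of_le hq), Finset.sum_mul]
    refine sum_mem fun i hi => ?_
    have hi' : i ≤ n := Nat.lt_succ_iff.1 (Finset.mem_range.1 hi)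
    obtain ⟨j, rfl⟩ := Nat.exists_eq_add_of_le hi'
    have : algebraMap R K (q.coeff i) * x ^ i * y ^ (i + j) = algebraMap R K (q.coeff i) * y ^ j := by
      rw [pow_add]
      have h : x ^ i * y ^ i = 1 := by rw [← mul_pow, hxy, one_pow]
      linear_combination (algebraMap R K (q.coeff i) * y ^ j) * h
    rw [this]
    exact mul_mem (S.algebraMap_mem _) (pow_mem hy _)
  obtain hn | hn := Nat.eq_zero_or_pos p.natDegree
  · have h1 := Polynomial.eq_one_of_monic_natDegree_zero hp hn
    rw [h1, Polynomial.eval₂_one] at he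
    rw [← mul_one x, he, mul_zero]
    exact zero_mem S
  · obtain ⟨n, hn⟩ := Nat.exists_eq_add_of_lt hn
    rw [zero_add] at hn
    have h2 := key n p.eraseLead (by have := p.eraseLead_natDegree_le; omega)
    have h3 := Polynomial.eraseLead_add_monomial_natDegree_leadingCoeff p
    have h4 : p.eraseLead.eval₂ (algebraMap R K) x + x ^ (n + 1) = 0 := by
      rw [← he]
      conv_rhs => rw [← h3]
      simp [hp.leadingCoeff, hn]
    have : x = -(p.eraseLead.eval₂ (algebraMap R K) x * y ^ n) := by
      have h5 : x ^ n * y ^ n = 1 := by rw [← mul_pow, hxy, one_pow]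
      linear_combination y ^ n * h4 - x * h5
    rw [this]
    exact neg_mem h2

/-- Take I = (x, y, 1) with I² = zI. As 1 ∈ I, the inverse of z carries I into I; z is integral, so
z also lies in E(I), and I² ⊆ I. -/
theorem HasReductions.exists_mul_eq (h : HasReductions R K) {S : Subalgebra R K}
    (hS : ∀ x ∈ S, IsIntegral R x) {x y : K} (hx : x ∈ S) (hy : y ∈ S) :
    ∃ a b c : R, x * y = algebraMap R K a * x + algebraMap R K b * y + algebraMap R K c := by
  let I : Submodule R K := Submodule.span R {x, y, 1}
  have h1 : (1 : K) ∈ I := Submodule.subset_span (by simp)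
  have hIS : I ≤ Subalgebra.toSubmodule S := by
    rw [Submodule.span_le]
    rintro _ (rfl | rfl | rfl)
    exacts [hx, hy, S.one_mem]
  obtain ⟨z, hz, hI⟩ := h I (Submodule.fg_span (by simp)) ⟨1, h1, isUnit_one⟩
  obtain ⟨y', -, hzy⟩ := hI 1 h1 1 h1
  have hy' : y' ∈ endRing I := fun w hw => by
    obtain ⟨v, hv, e⟩ := hI 1 h1 w hw
    have : y' * w = v := by linear_combination y' * e - v * hzy
    rwa [this]
  have hz' : z ∈ endRing I :=
    mem_of_isIntegral_of_mul_eq_one (hS z (hIS hz)) (by rw [← hzy, one_mul]) hy'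
  obtain ⟨w, hw, e⟩ := hI x (Submodule.subset_span (by simp)) y (Submodule.subset_span (by simp))
  obtain ⟨a, b, c, habc⟩ := Submodule.mem_span_triple.1 (hz' w hw)
  refine ⟨a, b, c, ?_⟩
  rw [e, ← habc]
  simp [Algebra.smul_def]

theorem HasReductions.exists_sq_eq (h : HasReductions R K) {S : Subalgebra R K}
    (hS : ∀ x ∈ S, IsIntegral R x) {x : K} (hx : x ∈ S) :
    ∃ a b : R, x ^ 2 = algebraMap R K a * x + algebraMap R K b := by
  obtain ⟨a, b, c, e⟩ := h.exists_mul_eq hS hx hx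
  exact ⟨a + b, c, by rw [sq, e, map_add]; ring⟩

variable [IsLocalRing R]

theorem _root_.Ideal.IsMaximal.exists_sub_one_mem_of_ne {A : Type*} [CommRing A]
    {P Q : Ideal A} (hP : P.IsMaximal) (hQ : Q.IsMaximal) (h : P ≠ Q) : ∃ a, a - 1 ∈ P ∧ a ∈ Q := by
  obtain ⟨b, hb, a, ha, e⟩ := Submodule.mem_sup.1
    ((Ideal.eq_top_iff_one _).1 (hP.coprime_of_ne hQ h))
  exact ⟨a, by rw [show a - 1 = -b by linear_combination e]; exact neg_mem hb, ha⟩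

theorem _root_.Ideal.IsMaximal.exists_sub_one_mem_of_ne_of_ne {A : Type*} [CommRing A]
    {P Q Q' : Ideal A} (hP : P.IsMaximal) (hQ : Q.IsMaximal) (hQ' : Q'.IsMaximal) (h : P ≠ Q)
    (h' : P ≠ Q') : ∃ a, Ideal.Quotient.mk P a = 1 ∧ Ideal.Quotient.mk Q a = 0 ∧
      Ideal.Quotient.mk Q' a = 0 := by
  obtain ⟨a, ha, ha'⟩ := hP.exists_sub_one_mem_of_ne hQ h
  obtain ⟨b, hb, hb'⟩ := hP.exists_sub_one_mem_of_ne hQ' h'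
  rw [← Ideal.Quotient.eq_zero_iff_mem, map_sub, map_one, sub_eq_zero] at ha hb
  rw [← Ideal.Quotient.eq_zero_iff_mem] at ha' hb'
  exact ⟨a * b, by simp [ha, hb], by simp [ha'], by simp [hb']⟩

theorem HasReductions.encard_isMaximal_le_two (h : HasReductions R K)
    (hreg : ∃ m ∈ IsLocalRing.maximalIdeal R, IsUnit (algebraMap R K m)) {S : Subalgebra R K}
    (hS : ∀ x ∈ S, IsIntegral R x) : {Q : Ideal S | Q.IsMaximal}.encard ≤ 2 := by
  by_contra! hlt
  obtain ⟨s, hs, hs3⟩ := Set.exists_subset_encard_eq (Order.add_one_le_of_lt hlt)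
  obtain ⟨P₁, P₂, P₃, h12, h13, h23, rfl⟩ := Set.encard_eq_three.1 (hs3.trans (by norm_num))
  have h1 : P₁.IsMaximal := hs (by simp)
  have h2 : P₂.IsMaximal := hs (by simp)
  have h3 : P₃.IsMaximal := hs (by simp)
  obtain ⟨e₁, h11, h12', h13'⟩ := h1.exists_sub_one_mem_of_ne_of_ne h2 h3 h12 h13
  obtain ⟨e₂, h22, h21', h23'⟩ := h2.exists_sub_one_mem_of_ne_of_ne h1 h3 h12.symm h23
  obtain ⟨e₃, h33, h31', h32'⟩ := h3.exists_sub_one_mem_of_ne_of_ne h1 h2 h13.symm h23.symm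
  obtain ⟨m, hm, hmu⟩ := hreg
  have hmk : ∀ {Q : Ideal S}, Q.IsMaximal → ∀ {r : R},
      Ideal.Quotient.mk Q (algebraMap R S r) = 0 ↔ r ∈ IsLocalRing.maximalIdeal R := fun hQ r => by
    rw [Ideal.Quotient.eq_zero_iff_mem, algebraMap_mem_iff_of_isMaximal hS hQ]
  -- The generators have residues (1, 1, 0), (0, 1, 1) and (0, 0, 0) at the three maximal ideals; m
  -- is there only to supply a unit of K. Since z divides the squares of the first two, its residues
  -- r, r + s, s are all nonzero.
  let I : Submodule R K :=
    Submodule.span R {((e₁ + e₂ : S) : K), ((e₂ + e₃ : S) : K), algebraMap R K m}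
  have hIS : I ≤ Subalgebra.toSubmodule S := by
    rw [Submodule.span_le]
    rintro _ (rfl | rfl | rfl)
    exacts [(e₁ + e₂).2, (e₂ + e₃).2, S.algebraMap_mem m]
  obtain ⟨z, hz, hI⟩ := h I (Submodule.fg_span (by simp))
    ⟨_, Submodule.subset_span (by simp), hmu⟩
  have hzS : ∀ x : S, (x : K) ∈ I → (⟨z, hIS hz⟩ : S) ∣ x * x := fun x hx => by
    obtain ⟨w, hw, e⟩ := hI _ hx _ hx
    exact ⟨⟨w, hIS hw⟩, Subtype.ext e⟩
  have hd1 := hzS (e₁ + e₂) (Submodule.subset_span (by simp))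
  have hd2 := hzS (e₂ + e₃) (Submodule.subset_span (by simp))
  obtain ⟨r, s, t, hrst⟩ := Submodule.mem_span_triple.1 hz
  have hzr : (⟨z, hIS hz⟩ : S) = algebraMap R S r * (e₁ + e₂) + algebraMap R S s * (e₂ + e₃) +
      algebraMap R S t * algebraMap R S m := by
    apply Subtype.ext
    refine hrst.symm.trans ?_
    simp [Algebra.smul_def]
  rw [hzr] at hd1 hd2
  have q1 := map_dvd (Ideal.Quotient.mk P₁) hd1
  have q2 := map_dvd (Ideal.Quotient.mk P₂) hd1
  have q3 := map_dvd (Ideal.Quotient.mk P₃) hd2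
  simp only [map_mul, map_add, h11, h22, h33, h12', h13', h21', h23', h31', h32', (hmk h1).2 hm,
    (hmk h2).2 hm, (hmk h3).2 hm, add_zero, zero_add, mul_one, mul_zero] at q1 q2 q3
  have := h1.isPrime
  have := h2.isPrime
  have := h3.isPrime
  have hr : r ∉ IsLocalRing.maximalIdeal R := fun hr => by
    rw [(hmk h1).2 hr, zero_dvd_iff] at q1
    exact one_ne_zero q1
  have hrs : r + s ∉ IsLocalRing.maximalIdeal R := fun hr => by
    rw [← map_add, ← map_add, (hmk h2).2 hr, zero_dvd_iff] at q2
    exact one_ne_zero q2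
  have hs' : s ∉ IsLocalRing.maximalIdeal R := fun hr => by
    rw [(hmk h3).2 hr, zero_dvd_iff] at q3
    exact one_ne_zero q3
  -- The residues 0, r, r + s of w are distinct, yet all are roots of one monic quadratic over the
  -- residue field of R.
  let w : S := algebraMap R S r * e₂ + algebraMap R S (r + s) * e₃
  obtain ⟨a, b, hab⟩ := h.exists_sq_eq hS w.2
  have hab' : w ^ 2 = algebraMap R S a * w + algebraMap R S b := Subtype.ext hab
  have w1 := congrArg (Ideal.Quotient.mk P₁) hab'
  have w2 := congrArg (Ideal.Quotient.mk P₂) hab'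
  have w3 := congrArg (Ideal.Quotient.mk P₃) hab'
  simp only [w, map_mul, map_add, map_pow, h22, h33, h21', h23', h31', h32',
    add_zero, zero_add, mul_one, mul_zero] at w1 w2 w3
  have hb : b ∈ IsLocalRing.maximalIdeal R := (hmk h1).1 (by rw [← w1]; ring)
  rw [(hmk h2).2 hb, add_zero] at w2
  rw [(hmk h3).2 hb, add_zero] at w3
  have k2 : r * (r - a) ∈ IsLocalRing.maximalIdeal R := (hmk h2).1 (by
    simp only [map_mul, map_sub]; linear_combination w2)
  have k3 : (r + s) * (r + s - a) ∈ IsLocalRing.maximalIdeal R := (hmk h3).1 (by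
    simp only [map_mul, map_sub, map_add]; linear_combination w3)
  have hM : (IsLocalRing.maximalIdeal R).IsPrime := inferInstance
  refine hs' ?_
  rw [show s = (r + s - a) - (r - a) by ring]
  exact sub_mem ((hM.mem_or_mem k3).resolve_left hrs) ((hM.mem_or_mem k2).resolve_left hr)

end Reductions

end StableRings

namespace StableRings

/-! ### One step of the tower: from A to E(Jac A) -/

section Step

variable {R K : Type*} [CommRing R] [CommRing K] [Algebra R K]

/-- The local rings `A` between `R` and `K` whose maximal ideal is of the form `m E(Jac A)` for
some unit `m` of `K`. -/
structure HasPrincipalJac (A : Subalgebra R K) : Prop where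
  unit_or_mem : ∀ a ∈ A, (∃ b ∈ A, a * b = 1) ∨ a ∈ jac A
  exists_generator : ∃ m ∈ jac A, IsUnit m ∧ ∀ x ∈ jac A, ∃ q ∈ endRing (jac A), x = m * q

theorem isIntegral_of_isIntegral_subalgebra {A : Subalgebra R K}
    (hA : ∀ x ∈ A, IsIntegral R x) {x : K} (hx : IsIntegral A x) : IsIntegral R x := by
  have := algebraIsIntegral hA
  exact isIntegral_trans x hx

theorem isIntegral_of_sq_eq {A : Subalgebra R K}
    (hA : ∀ x ∈ A, IsIntegral R x) {x a b : K} (ha : a ∈ A) (hb : b ∈ A)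
    (h : x ^ 2 = a * x + b) : IsIntegral R x := by
  refine isIntegral_of_isIntegral_subalgebra hA
    ⟨.X ^ 2 - (.C ⟨a, ha⟩ * .X + .C ⟨b, hb⟩), ?_, ?_⟩
  · nontriviality A
    refine Polynomial.monic_X_pow_sub ?_
    compute_degree!
  · simp only [Polynomial.eval₂_sub, Polynomial.eval₂_pow, Polynomial.eval₂_X,
      Polynomial.eval₂_add, Polynomial.eval₂_mul, Polynomial.eval₂_C]
    exact sub_eq_zero.2 h

variable [IsLocalRing R]

/-- Take (x, 1)² = z(x, 1). If z ∈ A, then x² = z(ax + b) is an integral equation. Write z = dx + c;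
a nonunit d sends x into Jac A, so z ∈ A. If d is a unit, write z⁻¹ = fz + g: a nonunit f puts z⁻¹,
hence z, in A, while a unit f turns fz² + gz = 1 into an integral equation for z, and x is an
R-linear combination of z and 1. -/
theorem HasReductions.isIntegral_of_mem_endRing_jac (h : HasReductions R K) [Nontrivial K]
    {A : Subalgebra R K} (hA : ∀ x ∈ A, IsIntegral R x)
    (hloc : ∀ a ∈ A, (∃ b ∈ A, a * b = 1) ∨ a ∈ jac A) {x : K} (hx : x ∈ endRing (jac A)) :
    IsIntegral R x := by
  have hcase : ∀ r : R, algebraMap R K r ∈ jac A ∨ ∃ r' : R, r * r' = 1 := fun r => by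
    by_cases hr : r ∈ IsLocalRing.maximalIdeal R
    · exact .inl (algebraMap_mem_jac hA hr)
    · exact .inr (isUnit_iff_exists_inv.1 (by simpa using hr))
  have hinv : ∀ {u v : K}, u ∈ A → v ∈ endRing (jac A) → u * v = 1 → v ∈ A := by
    intro u v hu hv huv
    obtain ⟨b, hb, e⟩ | hu := hloc u hu
    · rwa [show v = b by linear_combination b * huv - v * e]
    · refine absurd (hv u hu) ?_
      rw [mul_comm, huv]
      exact one_notMem_jac A
  let I : Submodule R K := Submodule.span R {x, 1}
  have h1 : (1 : K) ∈ I := Submodule.subset_span (by simp)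
  have hxI : x ∈ I := Submodule.subset_span (by simp)
  have hI' : I ≤ Subalgebra.toSubmodule (endRing (jac A)) := by
    rw [Submodule.span_le]
    rintro _ (rfl | rfl)
    exacts [hx, (endRing (jac A)).one_mem]
  obtain ⟨z, hz, hI⟩ := h I (Submodule.fg_span (by simp)) ⟨1, h1, isUnit_one⟩
  obtain ⟨z', hz', hzz⟩ := hI 1 h1 1 h1
  rw [one_mul] at hzz
  have hzA : z ∈ A → IsIntegral R x := fun hzA => by
    obtain ⟨w, hw, e⟩ := hI x hxI x hxI
    obtain ⟨a, b, rfl⟩ := Submodule.mem_span_pair.1 hw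
    refine isIntegral_of_sq_eq hA (mul_mem hzA (A.algebraMap_mem a))
      (mul_mem hzA (A.algebraMap_mem b)) ?_
    rw [sq, e]
    simp only [Algebra.smul_def]
    ring
  have hform : ∀ y ∈ I, ∃ a b : R, y = algebraMap R K a * x + algebraMap R K b := fun y hy => by
    obtain ⟨a, b, e⟩ := Submodule.mem_span_pair.1 hy
    exact ⟨a, b, by rw [← e]; simp [Algebra.smul_def]⟩
  obtain ⟨d, c, hdc⟩ := hform z hz
  obtain hd | ⟨d', hd⟩ := hcase d
  · refine hzA ?_
    rw [hdc, mul_comm]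
    exact add_mem (jac_le (hx _ hd)) (A.algebraMap_mem c)
  have hd' : algebraMap R K d * algebraMap R K d' = 1 := by rw [← map_mul, hd, map_one]
  have hxz : x = algebraMap R K d' * z - algebraMap R K (d' * c) := by
    rw [map_mul]
    linear_combination -x * hd' - algebraMap R K d' * hdc
  obtain ⟨f₀, g₀, hfg⟩ := hform z' hz'
  have hzf : z' = algebraMap R K (f₀ * d') * z + algebraMap R K (g₀ - f₀ * (d' * c)) := by
    rw [hfg, hxz]
    simp only [map_mul, map_sub]
    ring
  generalize f₀ * d' = f, g₀ - f₀ * (d' * c) = g at hzf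
  obtain hf | ⟨f', hf⟩ := hcase f
  · refine hzA (hinv (u := z') ?_ (hI' hz) (by rw [mul_comm, ← hzz]))
    rw [hzf, mul_comm]
    exact add_mem (jac_le (hI' hz _ hf)) (A.algebraMap_mem g)
  · have hf' : algebraMap R K f * algebraMap R K f' = 1 := by rw [← map_mul, hf, map_one]
    have hzint : IsIntegral R z := by
      refine isIntegral_of_sq_eq hA (A.algebraMap_mem (-(f' * g))) (A.algebraMap_mem f') ?_
      simp only [map_mul, map_neg]
      linear_combination (-z ^ 2) * hf' - algebraMap R K f' * z * hzf - algebraMap R K f' * hzz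
    rw [hxz]
    exact (isIntegral_algebraMap.mul hzint).sub isIntegral_algebraMap

theorem algebraMap_mem_jac_iff [Nontrivial K] {S : Subalgebra R K}
    (hS : ∀ x ∈ S, IsIntegral R x) {r : R} :
    algebraMap R K r ∈ jac S ↔ r ∈ IsLocalRing.maximalIdeal R := by
  refine ⟨fun h => ?_, algebraMap_mem_jac hS⟩
  by_contra hr
  obtain ⟨s, hs⟩ := isUnit_iff_exists_inv.1 (show IsUnit r by simpa using hr)
  refine one_notMem_jac S ?_
  rw [← map_one (algebraMap R K), ← hs, mul_comm, map_mul]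
  exact mul_mem_jac (S.algebraMap_mem s) h

/-- In the endomorphism ring `B` of the maximal ideal of `A`, either `Jac B = Jac A` or `B` is
local. -/
theorem HasReductions.unit_or_mem_jac (h : HasReductions R K) [Nontrivial K]
    {A : Subalgebra R K} (hA : ∀ x ∈ A, IsIntegral R x)
    (hB : ∀ x ∈ endRing (jac A), IsIntegral R x) {n : K}
    (hn : n ∈ jac (endRing (jac A))) (hnA : n ∉ jac A) {u : K} (hu : u ∈ endRing (jac A)) :
    (∃ v ∈ endRing (jac A), u * v = 1) ∨ u ∈ jac (endRing (jac A)) := by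
  set B := endRing (jac A) with hBdef
  have hnB : n ∈ B := jac_le hn
  have hM : ∀ {r : R}, r ∈ IsLocalRing.maximalIdeal R → ∀ {b : K}, b ∈ B →
      algebraMap R K r * b ∈ jac A := fun hr b hb => by
    rw [mul_comm]
    exact hb _ (algebraMap_mem_jac hA hr)
  have hsq : ∀ {x : K} {r s : R}, x ∈ B → r ∈ IsLocalRing.maximalIdeal R →
      s ∈ IsLocalRing.maximalIdeal R → x ^ 2 = algebraMap R K r * x + algebraMap R K s →
      x ∈ jac B := fun hx hr hs e => by
    refine mem_jac_of_sq_mem hx (jac_le_jac_endRing_jac A ?_)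
    rw [e]
    exact add_mem (hM hr hx) (algebraMap_mem_jac hA hs)
  refine or_iff_not_imp_left.2 fun hnu => ?_
  obtain ⟨Q, hQ, huQ⟩ := exists_max_ideal_of_mem_nonunits (a := (⟨u, hu⟩ : B)) fun hu' => by
    obtain ⟨v, hv⟩ := isUnit_iff_exists_inv.1 hu'
    exact hnu ⟨v, v.2, congrArg Subtype.val hv⟩
  have hnQ : (⟨n, hnB⟩ : B) ∈ Q := (coe_mem_jac (x := ⟨n, hnB⟩)).1 hn Q hQ
  have hconst : ∀ {x : B} {r s : R}, x ∈ Q →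
      (x : K) ^ 2 = algebraMap R K r * x + algebraMap R K s →
      s ∈ IsLocalRing.maximalIdeal R := fun {x r s} hx e => by
    rw [← algebraMap_mem_iff_of_isMaximal hB hQ]
    have : algebraMap R B s = (x - algebraMap R B r) * x :=
      Subtype.ext (show algebraMap R K s = (x - algebraMap R K r) * x by linear_combination -e)
    rw [this]
    exact Q.mul_mem_left _ hx
  obtain ⟨r, s, e⟩ := h.exists_sq_eq hB hu
  have hs := hconst huQ e
  by_cases hr : r ∈ IsLocalRing.maximalIdeal R
  · exact hsq hu hr hs e
  obtain ⟨r', hr'⟩ := isUnit_iff_exists_inv.1 (show IsUnit r by simpa using hr)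
  have hrr : algebraMap R K r * algebraMap R K r' = 1 := by rw [← map_mul, hr', map_one]
  have hr'B : algebraMap R K r' ∈ B := B.algebraMap_mem r'
  -- Rescaling u makes it idempotent modulo Jac A. If it is not in Jac B, it separates Q from some
  -- maximal ideal Q'.
  set f := algebraMap R K r' * u with hf
  have hfB : f ∈ B := mul_mem hr'B hu
  have hfQ : (⟨f, hfB⟩ : B) ∈ Q := Q.mul_mem_left ⟨_, hr'B⟩ huQ
  have huf : u = algebraMap R K r * f := by linear_combination -u * hrr + algebraMap R K r * hf
  have hff : f ^ 2 - f ∈ jac A := by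
    have : f ^ 2 - f = algebraMap R K s * algebraMap R K r' ^ 2 := by
      linear_combination algebraMap R K r' ^ 2 * e + (f + algebraMap R K r' * u) * hf +
        (algebraMap R K r' * u) * hrr - hf
    rw [this]
    exact hM hs (pow_mem hr'B 2)
  suffices hfJ : f ∈ jac B by
    rw [huf]
    exact mul_mem_jac (B.algebraMap_mem r) hfJ
  by_contra hfJ
  obtain ⟨Q', hQ', hfQ'⟩ := exists_isMaximal_notMem (x := (⟨f, hfB⟩ : B)) hfJ
  -- The quadratic equation of f + n has roots 0 at Q and 1 at Q', so f + n is also idempotent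
  -- modulo Jac A. Comparing with f puts (1 - 2f - n)n in Jac A, and the first factor will turn out
  -- to be a unit.
  have hfnB : f + n ∈ B := add_mem hfB hnB
  have hfnQ : (⟨f + n, hfnB⟩ : B) ∈ Q := Q.add_mem hfQ hnQ
  obtain ⟨a, b, hab⟩ := h.exists_sq_eq hB hfnB
  have hb := hconst hfnQ hab
  have hJQ' : ∀ {x : K} (hx : x ∈ jac B), (⟨x, jac_le hx⟩ : B) ∈ Q' := fun hx =>
    (coe_mem_jac (x := ⟨_, jac_le hx⟩)).1 hx Q' hQ'
  have ha : 1 - a ∈ IsLocalRing.maximalIdeal R := by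
    rw [← algebraMap_mem_iff_of_isMaximal hB hQ']
    refine (hQ'.isPrime.mem_or_mem (x := ⟨f, hfB⟩) ?_).resolve_left hfQ'
    have h1 : f * (1 - algebraMap R K a) ∈ jac B := by
      have : f * (1 - algebraMap R K a) = -(f ^ 2 - f) + (algebraMap R K a - 2 * f - n) * n +
          algebraMap R K b := by linear_combination hab
      rw [this]
      refine add_mem (add_mem (neg_mem (jac_le_jac_endRing_jac A hff)) (mul_mem_jac ?_ hn))
        (algebraMap_mem_jac hB hb)
      exact sub_mem (sub_mem (B.algebraMap_mem a) (mul_mem (ofNat_mem B 2) hfB)) hnB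
    convert hJQ' h1 using 1
    apply Subtype.ext
    simp
  have h2 : (1 - 2 * f - n) * n ∈ jac A := by
    have : (1 - 2 * f - n) * n = f ^ 2 - f + algebraMap R K (1 - a) * (f + n) - algebraMap R K b := by
      rw [map_sub, map_one]
      linear_combination -hab
    rw [this]
    exact sub_mem (add_mem hff (hM ha hfnB)) (algebraMap_mem_jac hA hb)
  -- (1 - 2f)² = 1 + 4(f² - f) is congruent to 1 modulo Jac B.
  have h2f : 1 - 2 * f ∈ B := sub_mem B.one_mem (mul_mem (ofNat_mem B 2) hfB)
  obtain ⟨y, hy, hxy⟩ : ∃ y ∈ B, (1 - 2 * f - n) * (1 - 2 * f) * y = 1 := by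
    refine exists_mul_eq_one_of_sub_mem_jac (u := 1) (v := 1) B.one_mem (mul_one 1) ?_
    have : (1 - 2 * f - n) * (1 - 2 * f) - 1 = 4 * (f ^ 2 - f) - (1 - 2 * f) * n := by ring
    rw [this]
    exact sub_mem (mul_mem_jac (ofNat_mem B 4) (jac_le_jac_endRing_jac A hff)) (mul_mem_jac h2f hn)
  refine hnA ?_
  rw [show n = ((1 - 2 * f) * y) * ((1 - 2 * f - n) * n) by linear_combination -n * hxy]
  exact (mul_mem h2f hy) _ h2

/-- The maximal ideal M of R satisfies MB ⊆ Jac A. The quadratic relations of elements of Jac B have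
constant term in M. If all coefficients lie in M, this suffices; a unit coefficient in x² = rx + s
makes x a multiple of s, and one in xy = ax + by + c reduces xy to a square. -/
theorem HasReductions.mul_mem_jac_of_mem_jac_endRing (h : HasReductions R K) [Nontrivial K]
    {A : Subalgebra R K} (hA : ∀ x ∈ A, IsIntegral R x)
    (hB : ∀ x ∈ endRing (jac A), IsIntegral R x) {x y : K}
    (hx : x ∈ jac (endRing (jac A))) (hy : y ∈ jac (endRing (jac A))) :
    x * y ∈ jac A := by
  set B := endRing (jac A) with hBdef
  have hM : ∀ {r : R}, r ∈ IsLocalRing.maximalIdeal R → ∀ {b : K}, b ∈ B →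
      algebraMap R K r * b ∈ jac A := fun hr b hb => by
    rw [mul_comm]
    exact hb _ (algebraMap_mem_jac hA hr)
  have hunit : ∀ {r : R}, r ∉ IsLocalRing.maximalIdeal R →
      ∃ s, algebraMap R K r * algebraMap R K s = 1 := fun {r} hr => by
    obtain ⟨s, hs⟩ := isUnit_iff_exists_inv.1 (show IsUnit r by simpa using hr)
    exact ⟨s, by rw [← map_mul, hs, map_one]⟩
  have hsq : ∀ {x : K}, x ∈ jac B → x ^ 2 ∈ jac A := fun {x} hx => by
    obtain ⟨r, s, e⟩ := h.exists_sq_eq hB (jac_le hx)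
    have hs : s ∈ IsLocalRing.maximalIdeal R := by
      rw [← algebraMap_mem_jac_iff hB, show algebraMap R K s = (x - algebraMap R K r) * x by
        linear_combination -e]
      exact mul_mem_jac (sub_mem (jac_le hx) (B.algebraMap_mem r)) hx
    by_cases hr : r ∈ IsLocalRing.maximalIdeal R
    · rw [e]
      exact add_mem (hM hr (jac_le hx)) (algebraMap_mem_jac hA hs)
    · obtain ⟨t, ht⟩ := hunit hr
      obtain ⟨y, hy, hxy⟩ : ∃ y ∈ B, (algebraMap R K r - x) * y = 1 :=
        exists_mul_eq_one_of_sub_mem_jac (B.algebraMap_mem t) ht (by simpa using neg_mem hx)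
      rw [show x ^ 2 = -(x * y) * algebraMap R K s by linear_combination (-x * y) * e - x ^ 2 * hxy]
      exact neg_mem (mul_mem (jac_le hx) hy) _ (algebraMap_mem_jac hA hs)
  obtain ⟨a, b, c, e⟩ := h.exists_mul_eq hB (jac_le hx) (jac_le hy)
  have hc : c ∈ IsLocalRing.maximalIdeal R := by
    rw [← algebraMap_mem_jac_iff hB, show algebraMap R K c =
      y * x - algebraMap R K a * x - algebraMap R K b * y by linear_combination -e]
    exact sub_mem (sub_mem (mul_mem_jac (jac_le hy) hx) (mul_mem_jac (B.algebraMap_mem a) hx))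
      (mul_mem_jac (B.algebraMap_mem b) hy)
  by_cases ha : a ∈ IsLocalRing.maximalIdeal R
  · by_cases hb : b ∈ IsLocalRing.maximalIdeal R
    · rw [e]
      exact add_mem (add_mem (hM ha (jac_le hx)) (hM hb (jac_le hy))) (algebraMap_mem_jac hA hc)
    · obtain ⟨t, ht⟩ := hunit hb
      rw [show x * y = (algebraMap R K t * (y - algebraMap R K a)) * x ^ 2 +
          -(algebraMap R K t * x) * algebraMap R K c by
        linear_combination -x * y * ht - algebraMap R K t * x * e]
      exact add_mem ((mul_mem (B.algebraMap_mem t) (sub_mem (jac_le hy) (B.algebraMap_mem a)) :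
        _ ∈ B) _ (hsq hx))
        ((neg_mem (mul_mem (B.algebraMap_mem t) (jac_le hx)) : _ ∈ B) _ (algebraMap_mem_jac hA hc))
  · obtain ⟨t, ht⟩ := hunit ha
    rw [show x * y = (algebraMap R K t * (x - algebraMap R K b)) * y ^ 2 +
        -(algebraMap R K t * y) * algebraMap R K c by
      linear_combination -x * y * ht - algebraMap R K t * y * e]
    exact add_mem ((mul_mem (B.algebraMap_mem t) (sub_mem (jac_le hx) (B.algebraMap_mem b)) :
      _ ∈ B) _ (hsq hy))
      ((neg_mem (mul_mem (B.algebraMap_mem t) (jac_le hy)) : _ ∈ B) _ (algebraMap_mem_jac hA hc))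

/-- Let N = Jac B, so N² ⊆ Jac A = mB. If N² ⊆ mN, then m⁻¹N ⊆ E(N) and m generates N over E(N).
Otherwise xy = mu for some x, y ∈ N and a unit u of B; then Ny ⊆ mB = xyB, and cancelling y gives N
= xB. -/
theorem HasPrincipalJac.endRing_jac (h : HasReductions R K) [Nontrivial K]
    {A : Subalgebra R K} (hA : ∀ x ∈ A, IsIntegral R x) (hp : HasPrincipalJac A) :
    jac (endRing (jac A)) = jac A ∨ HasPrincipalJac (endRing (jac A)) := by
  have hB := fun x => h.isIntegral_of_mem_endRing_jac hA hp.unit_or_mem (x := x)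
  have hJJ := fun x y => h.mul_mem_jac_of_mem_jac_endRing hA hB (x := x) (y := y)
  obtain ⟨m, hm, hmu, hgen⟩ := hp.exists_generator
  refine or_iff_not_imp_left.2 fun hne => ?_
  obtain ⟨n, hn, hnA⟩ : ∃ n ∈ jac (endRing (jac A)), n ∉ jac A := by
    by_contra! hle
    exact hne (le_antisymm hle (jac_le_jac_endRing_jac A))
  have hloc := fun u => h.unit_or_mem_jac hA hB hn hnA (u := u)
  refine ⟨hloc, ?_⟩
  by_cases hJ : ∀ x ∈ jac (endRing (jac A)), ∀ y ∈ jac (endRing (jac A)),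
      ∃ u ∈ jac (endRing (jac A)), x * y = m * u
  · obtain ⟨m', hm'⟩ := isUnit_iff_exists_inv.1 hmu
    refine ⟨m, jac_le_jac_endRing_jac A hm, hmu, fun x hx => ⟨m' * x, fun y hy => ?_, ?_⟩⟩
    · obtain ⟨u, hu, e⟩ := hJ x hx y hy
      rwa [show m' * x * y = u by linear_combination m' * e + u * hm']
    · linear_combination -x * hm'
  · push Not at hJ
    obtain ⟨x, hx, y, hy, hxy⟩ := hJ
    obtain ⟨u, hu, hxyu⟩ := hgen _ (hJJ x y hx hy)
    obtain ⟨v, hv, huv⟩ := (hloc u hu).resolve_right fun hu' => hxy u hu' hxyu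
    have hxyu' : IsUnit (x * y) := hxyu ▸ hmu.mul (isUnit_iff_exists_inv.2 ⟨v, huv⟩)
    obtain ⟨y', hy'⟩ := isUnit_iff_exists_inv.1 (isUnit_of_mul_isUnit_right hxyu')
    refine ⟨x, hx, isUnit_of_mul_isUnit_left hxyu', fun w hw => ?_⟩
    obtain ⟨q, hq, e⟩ := hgen _ (hJJ w y hw hy)
    refine ⟨v * q, le_endRing_jac _ (mul_mem hv hq), ?_⟩
    linear_combination y' * e - m * q * y' * huv - v * q * y' * hxyu - (w - x * (v * q)) * hy'

theorem HasReductions.isIntegral_of_mem_tower (h : HasReductions R K) [Nontrivial K]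
    (hbot : HasPrincipalJac (⊥ : Subalgebra R K)) (n : ℕ) :
    (∀ x ∈ tower R K n, IsIntegral R x) ∧
      (HasPrincipalJac (tower R K n) ∨ tower R K (n + 1) = tower R K n) := by
  induction n with
  | zero =>
    refine ⟨fun x hx => ?_, .inl hbot⟩
    obtain ⟨r, rfl⟩ := Algebra.mem_bot.1 hx
    exact isIntegral_algebraMap
  | succ n ih =>
    obtain ⟨hint, hp | heq⟩ := ih
    · refine ⟨fun x => h.isIntegral_of_mem_endRing_jac hint hp.unit_or_mem, ?_⟩
      obtain heq | hp' := hp.endRing_jac h hint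
      · exact .inr (congrArg endRing heq)
      · exact .inl hp'
    · refine ⟨by rwa [heq], .inr ?_⟩
      exact congrArg (fun A => endRing (jac A)) heq

theorem HasReductions.isIntegral_of_mem_towerUnion (h : HasReductions R K) [Nontrivial K]
    (hbot : HasPrincipalJac (⊥ : Subalgebra R K)) {x : K} (hx : x ∈ towerUnion R K) :
    IsIntegral R x := by
  obtain ⟨i, hi⟩ := Set.mem_iUnion.1 hx
  exact (h.isIntegral_of_mem_tower hbot (i + 1)).1 x hi

end Step

end StableRings

namespace StableRings

/-! ### Invertible modules over their endomorphism rings -/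

section Invertible

variable {R K : Type*} [CommRing R] [CommRing K] [Algebra R K]

/-- The elements of `K` that multiply `I` into `E(I)`. -/
def dual (I : Submodule R K) : Submodule R K :=
  Subalgebra.toSubmodule (endRing I) / I

theorem mem_dual {I : Submodule R K} {y : K} : y ∈ dual I ↔ ∀ x ∈ I, y * x ∈ endRing I :=
  Submodule.mem_div_iff_forall_mul_mem

theorem mul_mem_dual {I : Submodule R K} {a y : K} (ha : a ∈ endRing I) (hy : y ∈ dual I) :
    a * y ∈ dual I := by
  rw [mem_dual] at hy ⊢
  intro x hx
  rw [mul_assoc]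
  exact mul_mem ha (hy x hx)

/-- Prime avoidance by induction: if vI falls into the new Q, add cy, where yI is not inside Q and c
lies in all the earlier maximal ideals but not in Q. -/
theorem exists_mem_dual_forall_notMem {I : Submodule R K} (hI : 1 ∈ I * dual I)
    (s : Finset (Ideal (endRing I))) (hs : ∀ Q ∈ s, Q.IsMaximal) :
    ∃ v ∈ dual I, ∀ Q ∈ s, ∃ x ∈ I, ∃ t : endRing I, (t : K) = v * x ∧ t ∉ Q := by
  classical
  induction s using Finset.induction_on with
  | empty => exact ⟨0, zero_mem _, by simp⟩
  | insert Q s hQs ih =>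
    have hQ := hs Q (by simp)
    obtain ⟨v, hv, hvs⟩ := ih fun P hP => hs P (by simp [hP])
    by_cases hvQ : ∃ x ∈ I, ∃ t : endRing I, (t : K) = v * x ∧ t ∉ Q
    · refine ⟨v, hv, fun P hP => ?_⟩
      obtain rfl | hP := Finset.mem_insert.1 hP
      exacts [hvQ, hvs P hP]
    push Not at hvQ
    obtain ⟨x, hx, y, hy, hxy⟩ : ∃ x ∈ I, ∃ y, ∃ hy : y ∈ dual I, ∃ h : y * x ∈ endRing I,
        (⟨y * x, h⟩ : endRing I) ∉ Q := by
      by_contra! hcon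
      have hle : I * dual I ≤ (Q.restrictScalars R).map (endRing I).val.toLinearMap :=
        Submodule.mul_le.2 fun x hx y hy =>
          ⟨⟨y * x, mem_dual.1 hy x hx⟩, hcon x hx y hy _, mul_comm _ _⟩
      obtain ⟨t, ht, h1⟩ := hle hI
      exact hQ.ne_top ((Ideal.eq_top_iff_one _).2 ((show t = 1 from Subtype.ext h1) ▸ ht))
    obtain ⟨hyx, hxyQ⟩ := hxy
    obtain ⟨c, hcs, hcQ⟩ := SetLike.not_le_iff_exists.1 fun hle : s.inf id ≤ Q => by
      obtain ⟨P, hP, hPQ⟩ := hQ.isPrime.inf_le'.1 hle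
      exact hQs ((hs P (by simp [hP])).eq_of_le hQ.ne_top hPQ ▸ hP)
    refine ⟨v + c * y, add_mem hv (mul_mem_dual c.2 hy), fun P hP => ?_⟩
    obtain rfl | hP := Finset.mem_insert.1 hP
    · refine ⟨x, hx, ⟨v * x, mem_dual.1 hv x hx⟩ + c * ⟨y * x, hyx⟩, ?_, fun hmem => ?_⟩
      · simp only [Subalgebra.coe_add, Subalgebra.coe_mul]
        ring
      · rw [Ideal.add_mem_iff_right _ (hvQ x hx _ rfl)] at hmem
        exact (hQ.isPrime.mem_or_mem hmem).elim hcQ hxyQ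
    · obtain ⟨x', hx', t, ht, htP⟩ := hvs P hP
      refine ⟨x', hx', t + c * ⟨y * x', mem_dual.1 hy x' hx'⟩, ?_, fun hmem => htP ?_⟩
      · simp only [Subalgebra.coe_add, Subalgebra.coe_mul, ht]
        ring
      · have hcP : c ∈ P := (Finset.inf_le (f := id) hP) hcs
        rwa [Ideal.add_mem_iff_left _ (P.mul_mem_right _ hcP)] at hmem

/-- An invertible ideal of a semilocal ring is principal. -/
theorem exists_generator_of_finite {I : Submodule R K} (hI : 1 ∈ I * dual I)
    (hfin : {Q : Ideal (endRing I) | Q.IsMaximal}.Finite) :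
    ∃ w ∈ I, ∀ x ∈ I, ∃ q ∈ endRing I, x = w * q := by
  obtain ⟨v, hv, hvQ⟩ := exists_mem_dual_forall_notMem hI hfin.toFinset (by simp)
  let J : Ideal (endRing I) :=
    { carrier := {t | ∃ x ∈ I, (t : K) = v * x}
      add_mem' := by
        rintro a b ⟨x, hx, ha⟩ ⟨y, hy, hb⟩
        exact ⟨x + y, add_mem hx hy, by rw [Subalgebra.coe_add, ha, hb, mul_add]⟩
      zero_mem' := ⟨0, zero_mem _, by simp⟩
      smul_mem' := by
        rintro c a ⟨x, hx, ha⟩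
        refine ⟨c * x, c.2 x hx, ?_⟩
        rw [smul_eq_mul, Subalgebra.coe_mul, ha]
        ring }
  have hJ : J = ⊤ := by
    by_contra hJ
    obtain ⟨Q, hQ, hJQ⟩ := Ideal.exists_le_maximal J hJ
    obtain ⟨x, hx, t, ht, htQ⟩ := hvQ Q (by simpa using hQ)
    exact htQ (hJQ ⟨x, hx, ht⟩)
  obtain ⟨w, hw, h1⟩ := (Ideal.eq_top_iff_one J).1 hJ
  rw [Subalgebra.coe_one] at h1
  exact ⟨w, hw, fun x hx => ⟨v * x, mem_dual.1 hv x hx, by linear_combination x * h1⟩⟩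

/-- If 1 = ∑ xᵢyᵢ with xᵢ ∈ I and yᵢ in the dual, then E(I) = ∑ Iyᵢ. -/
theorem finite_endRing {I : Submodule R K} (hI : 1 ∈ I * dual I) (hfg : I.FG) :
    Module.Finite R (endRing I) := by
  obtain ⟨T, T', hT, hT', h1⟩ := Submodule.mem_span_mul_finite_of_mem_mul hI
  have hT'' : Submodule.span R (T' : Set K) ≤ dual I := Submodule.span_le.2 hT'
  have h1' : (1 : K) ∈ I * Submodule.span R (T' : Set K) := by
    rw [← Submodule.span_mul_span] at h1
    exact mul_le_mul_left (Submodule.span_le.2 hT) _ h1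
  have heq : Subalgebra.toSubmodule (endRing I) = I * Submodule.span R (T' : Set K) := by
    refine le_antisymm (fun q hq => ?_) (Submodule.mul_le.2 fun x hx y hy => ?_)
    · have hle : I * Submodule.span R (T' : Set K) ≤
          (I * Submodule.span R (T' : Set K)).comap (LinearMap.mulLeft R q) :=
        Submodule.mul_le.2 fun x hx y hy => by
          rw [Submodule.mem_comap, LinearMap.mulLeft_apply, ← mul_assoc]
          exact Submodule.mul_mem_mul (hq x hx) hy
      simpa using hle h1'
    · rw [mul_comm]
      exact mem_dual.1 (hT'' hy) x hx
  have : (Subalgebra.toSubmodule (endRing I)).FG :=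
    heq ▸ hfg.mul (Submodule.fg_span T'.finite_toSet)
  exact Module.Finite.iff_fg.2 this

theorem finite_isMaximal [IsLocalRing R] (S : Type*) [CommRing S] [Algebra R S]
    [Module.Finite R S] : {Q : Ideal S | Q.IsMaximal}.Finite := by
  refine (Algebra.QuasiFinite.finite_primesOver (S := S)
    (IsLocalRing.maximalIdeal R)).subset fun Q hQ => ?_
  have hQ : Q.IsMaximal := hQ
  exact ⟨hQ.isPrime, ⟨(IsLocalRing.eq_maximalIdeal
    (Ideal.isMaximal_comap_of_isIntegral_of_isMaximal (R := R) Q)).symm⟩⟩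

end Invertible

/-! ### From stable ideals to reductions and to the base of the tower -/

section Stable

variable {R : Type*} [CommRing R] (K : Type*) [CommRing K] [Algebra R K]

/-- The image in `K` of an ideal of `R`. -/
abbrev toFractional (J : Ideal R) : Submodule R K :=
  Submodule.map (Algebra.linearMap R K) J

theorem jac_bot [IsLocalRing R] [Nontrivial K] :
    jac (⊥ : Subalgebra R K) = toFractional K (IsLocalRing.maximalIdeal R) := by
  have hint : ∀ x ∈ (⊥ : Subalgebra R K), IsIntegral R x := fun x hx => by
    obtain ⟨r, rfl⟩ := Algebra.mem_bot.1 hx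
    exact isIntegral_algebraMap
  ext x
  constructor
  · intro hx
    obtain ⟨r, rfl⟩ := Algebra.mem_bot.1 (jac_le hx)
    exact ⟨r, (algebraMap_mem_jac_iff hint).1 hx, rfl⟩
  · rintro ⟨r, hr, rfl⟩
    exact algebraMap_mem_jac hint hr

variable [IsFractionRing R K]

/-- Dual basis lemma: a section s of the canonical surjection from the free module on J has
coordinates J → End J. With a regular r ∈ J, each is multiplication by an element of K, which lies
in the dual. -/
theorem IsStableIdeal.one_mem_mul_dual {J : Ideal R} (hJ : IsStableIdeal J)
    (hreg : IsRegularIdeal J) : 1 ∈ toFractional K J * dual (toFractional K J) := by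
  obtain ⟨s, hs⟩ := hJ.out
  obtain ⟨r, hrJ, hr⟩ := hreg
  obtain ⟨ri, hri⟩ := isUnit_iff_exists_inv.1 (IsLocalization.map_units K (⟨r, hr⟩ : R⁰))
  let ρ : J := ⟨r, hrJ⟩
  have hend : ∀ (φ : Module.End R J) (b : J), r * (φ b : R) = b * (φ ρ : R) := fun φ b => by
    have : r • b = (b : R) • ρ := Subtype.ext (mul_comm _ _)
    simpa using congrArg Subtype.val (congrArg φ this)
  have hs_smul : ∀ (c : R) (x e b : J), (s (c • x) e b : R) = c * (s x e b : R) := fun c x e b => by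
    have : c • x = algebraMap R (Module.End R J) c • x := rfl
    rw [this, map_smul]
    rfl
  have hs_mul : ∀ x e b : J, r * (r * (s x e b : R)) = x * b * (s ρ e ρ : R) := fun x e b => by
    have : r • x = (x : R) • ρ := Subtype.ext (mul_comm _ _)
    rw [← hs_smul, this, hs_smul, mul_left_comm, hend, mul_assoc]
  -- One factor r⁻¹ turns the endomorphism `s ρ e` into its multiplier; the other normalises the
  -- coordinate map, evaluated at r.
  have hdual : ∀ e : J, algebraMap R K (s ρ e ρ) * ri ^ 2 ∈ dual (toFractional K J) := fun e => by
    rw [mem_dual]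
    rintro _ ⟨x, hx, rfl⟩ _ ⟨b, hb, rfl⟩
    refine ⟨s ⟨x, hx⟩ e ⟨b, hb⟩, (s ⟨x, hx⟩ e ⟨b, hb⟩).2, ?_⟩
    have h := congrArg (algebraMap R K) (hs_mul ⟨x, hx⟩ e ⟨b, hb⟩)
    simp only [map_mul] at h
    simp only [Algebra.linearMap_apply]
    linear_combination ri ^ 2 * h -
      (algebraMap R K (s ⟨x, hx⟩ e ⟨b, hb⟩ : R)) * (algebraMap R K r * ri + 1) * hri
  have hsum : (1 : K) = ∑ e ∈ (s ρ).support,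
      algebraMap R K e * (algebraMap R K (s ρ e ρ) * ri ^ 2) := by
    have h1 : r = ∑ e ∈ (s ρ).support, (s ρ e e : R) := by
      have := congrArg Subtype.val (hs ρ)
      rw [Finsupp.linearCombination_apply, Finsupp.sum] at this
      simpa using this.symm
    have h2 : ∀ e : J, algebraMap R K e * (algebraMap R K (s ρ e ρ) * ri ^ 2) =
        algebraMap R K (s ρ e e) * ri := fun e => by
      have h := congrArg (algebraMap R K) (hend (s ρ e) e)
      simp only [map_mul] at h
      linear_combination -ri ^ 2 * h + algebraMap R K (s ρ e e) * ri * hri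
    rw [Finset.sum_congr rfl fun e _ => h2 e, ← Finset.sum_mul, ← map_sum, ← h1]
    exact hri.symm
  rw [hsum]
  exact sum_mem fun e _ => Submodule.mul_mem_mul ⟨e, e.2, rfl⟩ (hdual e)

variable [IsLocalRing R]

theorem IsFinitelyStable.hasReductions (h : IsFinitelyStable R) : HasReductions R K := by
  intro I hfg ⟨u, hu, huu⟩
  obtain ⟨S, rfl⟩ := hfg
  obtain ⟨⟨d, hd⟩, hdS⟩ := IsLocalization.exist_integer_multiples_of_finset R⁰ S
  set I := Submodule.span R (S : Set K)
  obtain ⟨di, hdi⟩ := isUnit_iff_exists_inv.1 (IsLocalization.map_units K (⟨d, hd⟩ : R⁰))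
  let I' : Submodule R K := I.map (LinearMap.mulLeft R (algebraMap R K d))
  -- Stability concerns ideals of R, so I is replaced by dI with d a common denominator; the
  -- reduction found for dI is scaled back by d⁻¹.
  let J : Ideal R := I'.comap (Algebra.linearMap R K)
  have hJI : toFractional K J = I' := by
    refine Submodule.map_comap_eq_self ?_
    rw [Submodule.map_le_iff_le_comap, Submodule.span_le]
    intro x hx
    obtain ⟨a, ha⟩ := hdS x hx
    exact ⟨a, by simpa [Algebra.smul_def] using ha⟩
  have hinj : Function.Injective (Algebra.linearMap R K) := IsFractionRing.injective R K
  have hJfg : J.FG := by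
    refine Submodule.fg_of_fg_map_injective _ hinj ?_
    change (toFractional K J).FG
    rw [hJI]
    exact (Submodule.fg_span S.finite_toSet).map _
  have hJreg : IsRegularIdeal J := by
    have hdu : algebraMap R K d * u ∈ I' := ⟨u, hu, rfl⟩
    obtain ⟨a, ha, e⟩ : algebraMap R K d * u ∈ toFractional K J := hJI ▸ hdu
    refine ⟨a, ha, ?_⟩
    have hau : IsUnit (algebraMap R K a) := by
      rw [Algebra.linearMap_apply] at e
      rw [e]
      exact (IsLocalization.map_units K (⟨d, hd⟩ : R⁰)).mul huu
    exact mem_nonZeroDivisors_of_injective (f := algebraMap R K) hinj hau.mem_nonZeroDivisors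
  have hone := (h J hJfg hJreg).one_mem_mul_dual K hJreg
  rw [hJI] at hone
  have := finite_endRing hone ((Submodule.fg_span S.finite_toSet).map _)
  obtain ⟨_, ⟨z, hz, rfl⟩, hgen⟩ := exists_generator_of_finite hone (finite_isMaximal (R := R) _)
  refine ⟨z, hz, fun x hx y hy => ?_⟩
  obtain ⟨q, hq, ex⟩ := hgen _ ⟨x, hx, rfl⟩
  obtain ⟨q', hq', ey⟩ := hgen _ ⟨y, hy, rfl⟩
  obtain ⟨w, hw, ew⟩ := (mul_mem hq hq' : _ ∈ endRing I') _ ⟨z, hz, rfl⟩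
  refine ⟨w, hw, ?_⟩
  simp only [LinearMap.mulLeft_apply] at ex ey ew
  have hx' : x = z * q := by linear_combination di * ex - (x - z * q) * hdi
  have hy' : y = z * q' := by linear_combination di * ey - (y - z * q') * hdi
  have hw' : w = q * q' * z := by linear_combination di * ew - (w - q * q' * z) * hdi
  rw [hx', hy', hw']
  ring

/-- The maximal ideal need not be finitely generated, so `finite_endRing` does not apply.
Semilocality of its endomorphism ring comes instead from integrality and the bound by two. -/
theorem HasReductions.hasPrincipalJac_bot (h : HasReductions R K) [Nontrivial K]
    (hstable : IsStableIdeal (IsLocalRing.maximalIdeal R))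
    (hregular : IsRegularIdeal (IsLocalRing.maximalIdeal R)) :
    HasPrincipalJac (⊥ : Subalgebra R K) := by
  have hloc : ∀ a ∈ (⊥ : Subalgebra R K),
      (∃ b ∈ (⊥ : Subalgebra R K), a * b = 1) ∨ a ∈ jac (⊥ : Subalgebra R K) := fun a ha => by
    obtain ⟨r, rfl⟩ := Algebra.mem_bot.1 ha
    by_cases hr : r ∈ IsLocalRing.maximalIdeal R
    · rw [jac_bot]
      exact .inr ⟨r, hr, rfl⟩
    · obtain ⟨s, hs⟩ := isUnit_iff_exists_inv.1 (show IsUnit r by simpa using hr)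
      exact .inl ⟨_, Subalgebra.algebraMap_mem _ s, by rw [← map_mul, hs, map_one]⟩
  have hint : ∀ x ∈ (⊥ : Subalgebra R K), IsIntegral R x := fun x hx => by
    obtain ⟨r, rfl⟩ := Algebra.mem_bot.1 hx
    exact isIntegral_algebraMap
  obtain ⟨m, hm, hmreg⟩ := hregular
  have hmu : IsUnit (algebraMap R K m) := IsLocalization.map_units K (⟨m, hmreg⟩ : R⁰)
  have hone := hstable.one_mem_mul_dual K ⟨m, hm, hmreg⟩
  rw [← jac_bot] at hone
  obtain ⟨w, hw, hgen⟩ := exists_generator_of_finite hone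
    (Set.finite_of_encard_le_coe (k := 2) (h.encard_isMaximal_le_two ⟨m, hm, hmu⟩
      fun x => h.isIntegral_of_mem_endRing_jac hint hloc))
  obtain ⟨q, -, e⟩ := hgen (algebraMap R K m) (jac_bot (R := R) K ▸ ⟨m, hm, rfl⟩)
  exact ⟨hloc, w, hw, isUnit_of_mul_isUnit_left (e ▸ hmu), hgen⟩

end Stable

end StableRings

/-- `K` is the total ring of quotients of `R`. -/
theorem theorem3p9 {R : Type*} [CommRing R] [IsLocalRing R]
    (K : Type*) [CommRing K] [Algebra R K] [IsFractionRing R K]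
    (hR : StableRings.IsFinitelyStable R)
    (hstable : StableRings.IsStableIdeal (IsLocalRing.maximalIdeal R))
    (hregular : StableRings.IsRegularIdeal (IsLocalRing.maximalIdeal R)) :
    StableRings.IsQuadraticRing R K ∧
      {N : Ideal (StableRings.towerUnion R K) | N.IsMaximal}.encard ≤ 2 := by
  have hinj : Function.Injective (algebraMap R K) := IsFractionRing.injective R K
  have : Nontrivial K := hinj.nontrivial
  have h := hR.hasReductions K
  have hbot := h.hasPrincipalJac_bot K hstable hregular
  have hint : ∀ x ∈ StableRings.towerUnion R K, IsIntegral R x :=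
    fun _ hx => h.isIntegral_of_mem_towerUnion hbot hx
  refine ⟨{ quadratic := ⟨?_, fun x y => ?_⟩, stable := hstable, regular := hregular }, ?_⟩
  · exact Function.Injective.of_comp (f := Subtype.val) hinj
  · obtain ⟨a, b, c, e⟩ := h.exists_mul_eq hint x.2 y.2
    refine ⟨a, b, c, Subtype.ext ?_⟩
    simpa [Algebra.smul_def] using e
  · obtain ⟨m, hm, hmreg⟩ := hregular
    exact h.encard_isMaximal_le_two
      ⟨m, hm, IsLocalization.map_units K (⟨m, hmreg⟩ : nonZeroDivisors R)⟩ hint
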